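/- Call a function $\Psi:\mathbb{R}_{>0}\to\mathbb{R}_{>0}$ \emph{admissible of degree $k$} ($k\geq 1$ an integer) if $\Psi(x)=o(x^{-2k+1})$ as $x\to\infty$ and if there is $x_0>0$ such that $\Psi(x)/\Psi(y)\geq (y/x)^{k-1}$ for all $x_0\leq x\leq y$; call it \emph{strictly admissible} if it is admissible of degree $k$ for every integer $k\geq 1$. For $j\geq 1$ put $\Psi_j(x)=\Psi(x^{1/j})\,x^{(j-1)/j}$, so that $\Psi_1=\Psi$. For an integer $j\geq 1$ and a function $\Phi:\mathbb{R}_{>0}\to\mathbb{R}$ let $\mathscr{K}_j(\Phi)$ be the set of all real numbers $\zeta$ that are not algebraic of degree $\leq j$ and for which \[ \max_{1\leq i\leq j}|\zeta^{i}q-p_i|\leq \Phi(q) \] holds for infinitely many $(q,p_1,\ldots,p_j)\in\mathbb{Z}_{\geq 1}\times\mathbb{Z}^{j}$. Let $I\subseteq(-1/2,1/2)$ be a nonempty open interval. If $\Psi$ is admissible of degree $k$ for some integer $k\geq 1$, then the set \[ \bigcap_{1\leq j\leq k}\Bigl(\mathscr{K}_j(\Psi_j)\setminus\bigcup_{c<1}\mathscr{K}_j(c\Psi_j)\Bigr)\cap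 I \] is uncountable. If $\Psi$ is strictly admissible, then the set \[ \bigcap_{j\geq 1}\Bigl(\mathscr{K}_j(\Psi_j)\setminus\bigcup_{c<1}\mathscr{K}_j(c\Psi_j)\Bigr)\cap I \] is uncountable. -/

import Mathlib

open Set Filter Asymptotics

/-- `Ψ : ℝ_{>0} → ℝ_{>0}` is admissible of degree `k`. Such a function is represented by a map
`ℝ → ℝ` that is positive on the positive reals; its values elsewhere play no role. -/
structure Admissible (k : ℕ) (Ψ : ℝ → ℝ) : Prop where
  pos : ∀ x : ℝ, 0 < x → 0 < Ψ x
  decay : Ψ =o[atTop] fun x : ℝ => x ^ (-2 * (k : ℤ) + 1)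
  mono : ∃ x₀ : ℝ, 0 < x₀ ∧ ∀ x y : ℝ, x₀ ≤ x → x ≤ y → (y / x) ^ ((k : ℤ) - 1) ≤ Ψ x / Ψ y

/-- Admissible of every positive integer degree. -/
def StrictlyAdmissible (Ψ : ℝ → ℝ) : Prop :=
  ∀ k : ℕ, 1 ≤ k → Admissible k Ψ

/-- `Ψ_j(x) = Ψ(x^{1/j}) x^{(j-1)/j}`, for `j ≥ 1` and `x > 0`. -/
noncomputable def psiSeq (Ψ : ℝ → ℝ) (j : ℕ) : ℝ → ℝ :=
  fun x => Ψ (x ^ (1 / (j : ℝ))) * x ^ (((j : ℝ) - 1) / (j : ℝ))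

/-- The real numbers that are not algebraic of degree at most `k`. -/
def notAlgebraicOfDegreeLE (k : ℕ) : Set ℝ :=
  {ζ | ¬ (IsAlgebraic ℚ ζ ∧ (minpoly ℚ ζ).natDegree ≤ k)}

/-- The set `𝒦_k(Ψ)`: the coordinate `p i` approximates `ζ ^ (i + 1)`, for `i = 0, …, k - 1`,
and `q` ranges over the positive integers. -/
def approxSet (k : ℕ) (Ψ : ℝ → ℝ) : Set ℝ :=
  {ζ | ζ ∈ notAlgebraicOfDegreeLE k ∧
    {v : ℕ × (Fin k → ℤ) | 0 < v.1 ∧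
      ∀ i : Fin k, |ζ ^ ((i : ℕ) + 1) * (v.1 : ℝ) - (v.2 i : ℝ)| ≤ Ψ (v.1 : ℝ)}.Infinite}

/-- The exact-order set `𝒦_k(Ψ) \ ⋃_{c < 1} 𝒦_k(cΨ)`. -/
def exactOrderSet (k : ℕ) (Ψ : ℝ → ℝ) : Set ℝ :=
  approxSet k Ψ \ ⋃ (c : ℝ) (_ : c < 1), approxSet k (fun x => c * Ψ x)

/-! Everything reduces to approximating `ζ` itself. At each denominator `q` take the partial
quotient `⌈1 / (Ψ q * q)⌉`, optionally plus one. The next denominator is then about `1 / Ψ q`, so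
the error at `q` is at most `Ψ q` and asymptotic to it; the optional one is harmless because `Ψ t *
t → 0`. The law of best approximation and the eventual monotonicity of `Ψ` extend the lower bound to
all denominators up to `y`, in terms of `Ψ y` (`exactlyApproximable_of_pairs`). The free bits give
an injection of Cantor space into the interval, and discarding the countably many algebraic values
leaves uncountably many `ζ`.

Such a `ζ` has exact order for every permitted `j`. If `m / n` is a good approximation, the common
denominator `n ^ j` serves for all powers of `ζ`; since `|ζ| < 1 / 2`, raising to powers loses no
constant (`mem_approxSet_psiSeq`). Conversely, let `Q = y ^ j` serve all powers and let `p / q` be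
the first approximation in lowest terms. The decay of `Ψ` makes `Q` times the error so small that
certain integers vanish, forcing `q ^ j ∣ Q` (`pow_dvd_of_approx`). Hence `q ≤ y`, and dividing the
first error by `Q / q ≥ y ^ (j - 1)` contradicts the uniform lower bound at `y` when `c < 1`
(`not_mem_approxSet_mul_psiSeq`). -/

/-! ### Convergents and best approximation. -/

/-- Numerators and denominators of continued-fraction type, with partial quotients `a`. -/
structure IsConvergentSeq (p q a : ℕ → ℤ) : Prop where
  p_rec : ∀ n, p (n + 2) = a n * p (n + 1) + p n
  q_rec : ∀ n, q (n + 2) = a n * q (n + 1) + q n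
  one_le_a : ∀ n, 1 ≤ a n
  q_zero_pos : 0 < q 0
  q_zero_le : q 0 ≤ q 1
  det_zero : p 1 * q 0 - p 0 * q 1 = 1

/-- The signed error `(-1)^n (qₙ ζ - pₙ)`. -/
def signedError (p q : ℕ → ℤ) (ζ : ℝ) (n : ℕ) : ℝ :=
  (-1) ^ n * (q n * ζ - p n)

namespace IsConvergentSeq

variable {p q a : ℕ → ℤ}

theorem q_pos_and_le (h : IsConvergentSeq p q a) (n : ℕ) : 0 < q n ∧ q n ≤ q (n + 1) := by
  induction n with
  | zero => exact ⟨h.q_zero_pos, h.q_zero_le⟩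
  | succ n ih =>
    have h1 := h.one_le_a n
    refine ⟨by linarith [ih.1, ih.2], ?_⟩
    rw [h.q_rec n]
    nlinarith [ih.1, ih.2]

theorem q_pos (h : IsConvergentSeq p q a) (n : ℕ) : 0 < q n := (h.q_pos_and_le n).1

theorem q_le_succ (h : IsConvergentSeq p q a) (n : ℕ) : q n ≤ q (n + 1) := (h.q_pos_and_le n).2

theorem le_q (h : IsConvergentSeq p q a) (n : ℕ) : (n : ℤ) ≤ q n := by
  have key : ∀ n : ℕ, ((n : ℤ) + 1) ≤ q (n + 1) := by
    intro n
    induction n with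
    | zero => have := h.q_pos 1; push_cast; linarith
    | succ n ih =>
      have h1 := h.one_le_a n
      have h2 := h.q_pos n
      have h3 := h.q_pos (n + 1)
      rw [h.q_rec n]
      push_cast
      nlinarith
  cases n with
  | zero => exact (h.q_pos 0).le
  | succ n => exact_mod_cast key n

theorem tendsto_q (h : IsConvergentSeq p q a) : Tendsto (fun n => (q n : ℝ)) atTop atTop :=
  tendsto_atTop_mono (fun n => by exact_mod_cast h.le_q n) tendsto_natCast_atTop_atTop

theorem det (h : IsConvergentSeq p q a) (n : ℕ) :
    p (n + 1) * q n - p n * q (n + 1) = (-1) ^ n := by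
  induction n with
  | zero => simpa using h.det_zero
  | succ n ih =>
    rw [h.p_rec n, h.q_rec n, pow_succ, ← ih]
    ring

theorem det_two (h : IsConvergentSeq p q a) (n : ℕ) :
    p (n + 2) * q n - p n * q (n + 2) = a n * (-1) ^ n := by
  rw [h.p_rec n, h.q_rec n, ← h.det n]
  ring

/-- Even-indexed fractions strictly increase, odd-indexed ones strictly decrease, and the former
stay below the latter. A point of the nested intervals is strictly inside each, because it also lies
in the next one. -/
theorem exists_limit (h : IsConvergentSeq p q a) : ∃ ζ : ℝ, ∀ n, 0 < signedError p q ζ n := by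
  have hq : ∀ n, (0 : ℝ) < q n := fun n => by exact_mod_cast h.q_pos n
  have hf : ∀ n, (p (2 * n) / q (2 * n) : ℝ) < p (2 * (n + 1)) / q (2 * (n + 1)) := by
    intro n
    rw [div_lt_div_iff₀ (hq _) (hq _)]
    have h1 := h.det_two (2 * n)
    have h2 := h.one_le_a (2 * n)
    rw [pow_mul] at h1
    norm_num at h1
    have h3 : p (2 * n) * q (2 * n + 2) < p (2 * n + 2) * q (2 * n) := by linarith
    exact_mod_cast h3
  have hg : ∀ n, (p (2 * (n + 1) + 1) / q (2 * (n + 1) + 1) : ℝ) <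
      p (2 * n + 1) / q (2 * n + 1) := by
    intro n
    rw [div_lt_div_iff₀ (hq _) (hq _)]
    have h1 := h.det_two (2 * n + 1)
    have h2 := h.one_le_a (2 * n + 1)
    rw [pow_succ, pow_mul] at h1
    norm_num at h1
    have h3 : p (2 * n + 1 + 2) * q (2 * n + 1) < p (2 * n + 1) * q (2 * n + 1 + 2) := by
      linarith
    exact_mod_cast h3
  have hfg : ∀ n, (p (2 * n) / q (2 * n) : ℝ) ≤ p (2 * n + 1) / q (2 * n + 1) := by
    intro n
    rw [div_le_div_iff₀ (hq _) (hq _)]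
    have h1 := h.det (2 * n)
    rw [pow_mul] at h1
    norm_num at h1
    have h3 : p (2 * n) * q (2 * n + 1) ≤ p (2 * n + 1) * q (2 * n) := by linarith
    exact_mod_cast h3
  have hmem := Monotone.ciSup_mem_iInter_Icc_of_antitone
    (f := fun n => (p (2 * n) / q (2 * n) : ℝ)) (g := fun n => (p (2 * n + 1) / q (2 * n + 1) : ℝ))
    (strictMono_nat_of_lt_succ hf).monotone (strictAnti_nat_of_succ_lt hg).antitone hfg
  set ζ : ℝ := ⨆ n, (p (2 * n) / q (2 * n) : ℝ)
  rw [mem_iInter] at hmem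
  refine ⟨ζ, fun n => ?_⟩
  unfold signedError
  rcases Nat.even_or_odd' n with ⟨m, rfl | rfl⟩
  · have h1 : (p (2 * m) / q (2 * m) : ℝ) < ζ := (hf m).trans_le (hmem (m + 1)).1
    rw [div_lt_iff₀ (hq _)] at h1
    rw [pow_mul]
    norm_num
    linarith
  · have h1 : ζ < (p (2 * m + 1) / q (2 * m + 1) : ℝ) := (hmem (m + 1)).2.trans_lt (hg m)
    rw [lt_div_iff₀ (hq _)] at h1
    rw [pow_succ, pow_mul]
    norm_num
    linarith

variable {ζ : ℝ}

theorem signedError_rec (h : IsConvergentSeq p q a) (n : ℕ) :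
    signedError p q ζ (n + 2) = signedError p q ζ n - a n * signedError p q ζ (n + 1) := by
  simp only [signedError, h.p_rec n, h.q_rec n, pow_succ]
  push_cast
  ring

theorem signedError_succ_lt (h : IsConvergentSeq p q a) (hζ : ∀ n, 0 < signedError p q ζ n)
    (n : ℕ) : signedError p q ζ (n + 1) < signedError p q ζ n := by
  have h1 := hζ (n + 2)
  have h2 : (1 : ℝ) ≤ a n := by exact_mod_cast h.one_le_a n
  rw [h.signedError_rec n] at h1
  nlinarith [hζ (n + 1)]

theorem signedError_identity (h : IsConvergentSeq p q a) (n : ℕ) :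
    q (n + 1) * signedError p q ζ n + q n * signedError p q ζ (n + 1) = 1 := by
  have h1 : ((p (n + 1) * q n - p n * q (n + 1) : ℤ) : ℝ) = ((-1) ^ n : ℤ) := by rw [h.det n]
  push_cast at h1
  have h2 : ((-1 : ℝ) ^ n) * (-1) ^ n = 1 := by rw [← mul_pow]; norm_num
  simp only [signedError, pow_succ]
  linear_combination (-1 : ℝ) ^ n * h1 + h2

theorem signedError_upper (h : IsConvergentSeq p q a) (hζ : ∀ n, 0 < signedError p q ζ n)
    (n : ℕ) : q (n + 1) * signedError p q ζ n < 1 := by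
  have h1 : (0 : ℝ) < q n := by exact_mod_cast h.q_pos n
  have h2 := mul_pos h1 (hζ (n + 1))
  linarith [h.signedError_identity (ζ := ζ) n]

theorem signedError_lower (h : IsConvergentSeq p q a) (hζ : ∀ n, 0 < signedError p q ζ n)
    (n : ℕ) : 1 < (q (n + 1) + q n) * signedError p q ζ n := by
  have h1 : (0 : ℝ) < q n := by exact_mod_cast h.q_pos n
  have h2 := mul_lt_mul_of_pos_left (h.signedError_succ_lt hζ n) h1
  linarith [h.signedError_identity (ζ := ζ) n]

theorem abs_eq_signedError (hζ : ∀ n, 0 < signedError p q ζ n) (n : ℕ) :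
    |q n * ζ - p n| = signedError p q ζ n := by
  have h1 : |signedError p q ζ n| = |q n * ζ - p n| := by
    simp [signedError, abs_mul]
  rw [← h1, abs_of_pos (hζ n)]

/-- The law of best approximation. -/
theorem signedError_le_abs (h : IsConvergentSeq p q a) (hζ : ∀ n, 0 < signedError p q ζ n)
    (n : ℕ) {r : ℤ} (hr : 0 < r) (hr' : r < q (n + 1)) (s : ℤ) :
    signedError p q ζ n ≤ |r * ζ - s| := by
  have hdet := h.det n
  have hsq : ((-1 : ℤ) ^ n) * (-1) ^ n = 1 := by rw [← mul_pow]; norm_num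
  -- Cramer's rule: two consecutive pairs have determinant ±1, so `(s, r)` is an integral
  -- combination of them.
  obtain ⟨u, hu⟩ : ∃ u : ℤ, u = (-1) ^ n * (r * p (n + 1) - s * q (n + 1)) := ⟨_, rfl⟩
  obtain ⟨v, hv⟩ : ∃ v : ℤ, v = (-1) ^ n * (s * q n - r * p n) := ⟨_, rfl⟩
  have hr1 : r = u * q n + v * q (n + 1) := by
    rw [hu, hv]
    linear_combination -(-1) ^ n * r * hdet - r * hsq
  have hs1 : s = u * p n + v * p (n + 1) := by
    rw [hu, hv]
    linear_combination -(-1) ^ n * s * hdet - s * hsq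
  have hq0 := h.q_pos n
  have hq1 := h.q_pos (n + 1)
  have hD0 := hζ n
  have hD1 := hζ (n + 1)
  have habs : |r * ζ - s| = |u * signedError p q ζ n - v * signedError p q ζ (n + 1)| := by
    have : u * signedError p q ζ n - v * signedError p q ζ (n + 1) =
        (-1) ^ n * (r * ζ - s) := by
      rw [hr1, hs1]
      simp only [signedError, pow_succ]
      push_cast
      ring
    rw [this, abs_mul]
    simp
  rw [habs]
  -- The constraint `0 < r < q (n + 1)` excludes `u = 0` and prevents `u`, `v` from having the same
  -- sign. Hence the two error terms reinforce each other.
  rcases lt_trichotomy u 0 with hu0 | hu0 | hu0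
  · have hv0 : 0 < v := by
      by_contra hv0
      nlinarith
    have hu2 : (u : ℝ) ≤ -1 := by exact_mod_cast Int.le_sub_one_of_lt hu0
    have hv2 : (0 : ℝ) < v := by exact_mod_cast hv0
    rw [le_abs]
    right
    nlinarith [mul_pos hv2 hD1]
  · exfalso
    rw [hu0] at hr1
    rcases le_or_gt v 0 with hv0 | hv0 <;> nlinarith
  · have hv0 : v ≤ 0 := by
      by_contra hv0
      nlinarith
    have hu2 : (1 : ℝ) ≤ u := by exact_mod_cast hu0
    have hv2 : (v : ℝ) ≤ 0 := by exact_mod_cast hv0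
    rw [le_abs]
    left
    nlinarith

/-- The limit determines the partial quotients once the initial pairs are fixed; this yields
injectivity of the construction. -/
theorem a_eq_floor (h : IsConvergentSeq p q a) (hζ : ∀ n, 0 < signedError p q ζ n) (n : ℕ) :
    a n = ⌊signedError p q ζ n / signedError p q ζ (n + 1)⌋ := by
  have h1 := h.signedError_rec (ζ := ζ) n
  have h2 := hζ (n + 2)
  have h3 := h.signedError_succ_lt hζ (n + 1)
  symm
  rw [Int.floor_eq_iff, le_div_iff₀ (hζ _), div_lt_iff₀ (hζ _)]
  constructor <;> linarith

end IsConvergentSeq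

/-! ### The family of continued fractions indexed by bit sequences. -/

/-- Pairs (numerator, denominator) generated from two initial pairs, where the partial quotient
at step `n` depends on `n` and on the current denominator. -/
def convergentPairs (A : ℕ → ℤ → ℤ) (x y : ℤ × ℤ) : ℕ → ℤ × ℤ
  | 0 => x
  | 1 => y
  | n + 2 => A n (convergentPairs A x y (n + 1)).2 • convergentPairs A x y (n + 1) +
      convergentPairs A x y n

/-- The partial quotient making the error at denominator `q` comparable to `Ψ q`. -/
noncomputable def exactQuotient (Ψ : ℝ → ℝ) (ε : ℕ → Bool) (n : ℕ) (q : ℤ) : ℤ :=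
  ⌈1 / (Ψ q * q)⌉ + (if ε n then 1 else 0)

section Family

variable {Ψ : ℝ → ℝ} {x y : ℤ × ℤ}

theorem isConvergentSeq_pairs (hpos : ∀ t : ℝ, 0 < t → 0 < Ψ t) (hx : 0 < x.2)
    (hxy : x.2 ≤ y.2) (hdet : y.1 * x.2 - x.1 * y.2 = 1) (ε : ℕ → Bool) :
    IsConvergentSeq (fun n => (convergentPairs (exactQuotient Ψ ε) x y n).1)
      (fun n => (convergentPairs (exactQuotient Ψ ε) x y n).2)
      (fun n => exactQuotient Ψ ε n (convergentPairs (exactQuotient Ψ ε) x y (n + 1)).2) := by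
  have hquot : ∀ n (r : ℤ), 0 < r → 1 ≤ exactQuotient Ψ ε n r := by
    intro n r hr
    have hr' : (0 : ℝ) < r := by exact_mod_cast hr
    have h1 : 0 < ⌈1 / (Ψ r * r)⌉ := by
      rw [Int.ceil_pos]
      have := hpos r hr'
      positivity
    unfold exactQuotient
    split_ifs <;> omega
  have hq : ∀ n, 0 < (convergentPairs (exactQuotient Ψ ε) x y n).2 ∧
      0 < (convergentPairs (exactQuotient Ψ ε) x y (n + 1)).2 := by
    intro n
    induction n with
    | zero => exact ⟨hx, by simpa [convergentPairs] using hx.trans_le hxy⟩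
    | succ n ih =>
      refine ⟨ih.2, ?_⟩
      have h1 := hquot n _ ih.2
      simp only [convergentPairs, Prod.snd_add, Prod.smul_snd, smul_eq_mul]
      nlinarith [ih.1, ih.2]
  refine ⟨fun n => ?_, fun n => ?_, fun n => hquot n _ (hq n).2, hx, ?_, ?_⟩
  · simp [convergentPairs]
  · simp [convergentPairs]
  · simpa [convergentPairs] using hxy
  · simpa [convergentPairs] using hdet

theorem bits_eq_of_limit_eq (hpos : ∀ t : ℝ, 0 < t → 0 < Ψ t) (hx : 0 < x.2)
    (hxy : x.2 ≤ y.2) (hdet : y.1 * x.2 - x.1 * y.2 = 1) {ε ε' : ℕ → Bool} {ζ : ℝ}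
    (h : ∀ n, 0 < signedError (fun n => (convergentPairs (exactQuotient Ψ ε) x y n).1)
      (fun n => (convergentPairs (exactQuotient Ψ ε) x y n).2) ζ n)
    (h' : ∀ n, 0 < signedError (fun n => (convergentPairs (exactQuotient Ψ ε') x y n).1)
      (fun n => (convergentPairs (exactQuotient Ψ ε') x y n).2) ζ n) : ε = ε' := by
  have hA : ∀ n, convergentPairs (exactQuotient Ψ ε) x y n =
        convergentPairs (exactQuotient Ψ ε') x y n →
      convergentPairs (exactQuotient Ψ ε) x y (n + 1) =
        convergentPairs (exactQuotient Ψ ε') x y (n + 1) →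
      exactQuotient Ψ ε n (convergentPairs (exactQuotient Ψ ε) x y (n + 1)).2 =
        exactQuotient Ψ ε' n (convergentPairs (exactQuotient Ψ ε') x y (n + 1)).2 := by
    intro n h0 h1
    have e := (isConvergentSeq_pairs hpos hx hxy hdet ε).a_eq_floor h n
    have e' := (isConvergentSeq_pairs hpos hx hxy hdet ε').a_eq_floor h' n
    simp only [signedError] at e e'
    rw [e, e', h0, h1]
  have hS : ∀ n, convergentPairs (exactQuotient Ψ ε) x y n =
        convergentPairs (exactQuotient Ψ ε') x y n ∧
      convergentPairs (exactQuotient Ψ ε) x y (n + 1) =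
        convergentPairs (exactQuotient Ψ ε') x y (n + 1) := by
    intro n
    induction n with
    | zero => exact ⟨by simp [convergentPairs], by simp [convergentPairs]⟩
    | succ n ih =>
      refine ⟨ih.2, ?_⟩
      have := hA n ih.1 ih.2
      simp only [convergentPairs]
      rw [this, ih.1, ih.2]
  -- Equal denominators give equal ceilings, so equal quotients leave equal bits.
  funext n
  have h1 := hA n (hS n).1 (hS n).2
  rw [(hS n).2] at h1
  unfold exactQuotient at h1
  cases h2 : ε n <;> cases h3 : ε' n <;> simp [h2, h3] at h1 ⊢

end Family

/-! ### Exact order for `ζ` itself. -/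

/-- `ζ` is approximable to the exact order `Ψ` by rationals. The second condition is uniform in
the sense that it bounds all denominators up to `y` in terms of `Ψ y`. -/
structure ExactlyApproximable (Ψ : ℝ → ℝ) (ζ : ℝ) : Prop where
  upper : ∃ᶠ n : ℕ in atTop, ∃ m : ℤ, |n * ζ - m| ≤ Ψ n
  lower : ∀ c < 1, ∀ᶠ y : ℝ in atTop, ∀ r : ℤ, 0 < r → (r : ℝ) ≤ y → ∀ m : ℤ,
    c * Ψ y < |r * ζ - m|

theorem exactlyApproximable_of_pairs {Ψ : ℝ → ℝ} {x y : ℤ × ℤ}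
    (hpos : ∀ t : ℝ, 0 < t → 0 < Ψ t)
    (hdecay : Tendsto (fun t => Ψ t * t) atTop (nhds 0))
    (hanti : ∃ x₀ : ℝ, ∀ s t : ℝ, x₀ ≤ s → s ≤ t → Ψ t ≤ Ψ s) (hx : 0 < x.2)
    (hxy : x.2 ≤ y.2) (hdet : y.1 * x.2 - x.1 * y.2 = 1) {ε : ℕ → Bool} {ζ : ℝ}
    (hζ : ∀ n, 0 < signedError (fun n => (convergentPairs (exactQuotient Ψ ε) x y n).1)
      (fun n => (convergentPairs (exactQuotient Ψ ε) x y n).2) ζ n) :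
    ExactlyApproximable Ψ ζ := by
  have H := isConvergentSeq_pairs hpos hx hxy hdet ε
  set p : ℕ → ℤ := fun n => (convergentPairs (exactQuotient Ψ ε) x y n).1
  set q : ℕ → ℤ := fun n => (convergentPairs (exactQuotient Ψ ε) x y n).2
  have hq : ∀ n, (0 : ℝ) < q n := fun n => by exact_mod_cast H.q_pos n
  have hΨ : ∀ n, 0 < Ψ (q n) := fun n => hpos _ (hq n)
  have hqle : ∀ n, (q n : ℝ) ≤ q (n + 1) := fun n => by exact_mod_cast H.q_le_succ n
  have hrec : ∀ n, (q (n + 2) : ℝ) = exactQuotient Ψ ε n (q (n + 1)) * q (n + 1) + q n :=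
    fun n => by exact_mod_cast H.q_rec n
  have hXq : ∀ n, 1 / (Ψ (q n) * q n) * q n = 1 / Ψ (q n) := by
    intro n
    have h1 := hq n
    have h2 := hΨ n
    field_simp
  have hlow : ∀ n, 1 / Ψ (q (n + 1)) ≤ q (n + 2) := by
    intro n
    have h1 : 1 / (Ψ (q (n + 1)) * q (n + 1)) ≤ exactQuotient Ψ ε n (q (n + 1)) := by
      refine (Int.le_ceil _).trans ?_
      unfold exactQuotient
      split_ifs <;> simp
    have h2 := mul_le_mul_of_nonneg_right h1 (hq (n + 1)).le
    rw [hXq] at h2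
    rw [hrec]
    linarith [hq n]
  -- Of the four copies of `q (n + 1)`, two cover the ceiling and the bit, one bounds `q n`, and one
  -- is the summand on the left.
  have hupp : ∀ n, (q (n + 2) : ℝ) + q (n + 1) ≤ 1 / Ψ (q (n + 1)) + 4 * q (n + 1) := by
    intro n
    have h1 : (exactQuotient Ψ ε n (q (n + 1)) : ℝ) ≤ 1 / (Ψ (q (n + 1)) * q (n + 1)) + 2 := by
      have := Int.ceil_lt_add_one (1 / (Ψ (q (n + 1)) * q (n + 1)))
      unfold exactQuotient
      split_ifs <;> push_cast <;> linarith
    have h2 := mul_le_mul_of_nonneg_right h1 (hq (n + 1)).le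
    rw [add_mul, hXq] at h2
    rw [hrec]
    linarith [hqle n]
  constructor
  · rw [frequently_atTop]
    intro N
    -- The quotient rule controls errors only from index 1 on, and `n ≤ q n` puts this denominator
    -- beyond `N`.
    refine ⟨(q (N + 1)).toNat, ?_, p (N + 1), ?_⟩
    · have := H.le_q (N + 1)
      push_cast at this
      omega
    · have hc : ((q (N + 1)).toNat : ℝ) = q (N + 1) := by
        exact_mod_cast Int.toNat_of_nonneg (H.q_pos (N + 1)).le
      rw [hc, IsConvergentSeq.abs_eq_signedError hζ]
      have h1 := H.signedError_upper hζ (N + 1)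
      have h2 := hlow N
      rw [div_le_iff₀ (hΨ _)] at h2
      nlinarith [hζ (N + 1), hΨ (N + 1), hq (N + 2)]
  · intro c hc
    obtain ⟨x₀, hx₀⟩ := hanti
    have hq_top := H.tendsto_q
    have hsmall : ∀ᶠ n in atTop, c * (1 + 4 * (Ψ (q n) * q n)) < 1 := by
      have h1 : Tendsto (fun n => c * (1 + 4 * (Ψ (q n) * q n))) atTop (nhds (c * (1 + 4 * 0))) :=
        ((hdecay.comp hq_top).const_mul 4 |>.const_add 1).const_mul c
      exact h1.eventually_lt_const (by simpa using hc)
    obtain ⟨N, hN⟩ := eventually_atTop.mp (hsmall.and (hq_top.eventually_ge_atTop x₀))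
    filter_upwards [eventually_ge_atTop (q (N + 1) : ℝ)] with t ht r hr hrt m
    have hex : ∃ n, t < q n := (hq_top.eventually_gt_atTop t).exists
    classical
    -- Bracket `t` between consecutive denominators: `q k ≤ t < q (k + 1)`.
    obtain ⟨k, hk⟩ : ∃ k, Nat.find hex = k + 1 := by
      refine Nat.exists_eq_succ_of_ne_zero fun h0 => ?_
      have h1 := Nat.find_spec hex
      rw [h0] at h1
      have h2 : (q 0 : ℝ) ≤ q (N + 1) :=
        monotone_nat_of_le_succ (f := fun n => (q n : ℝ)) hqle (Nat.zero_le _)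
      linarith
    have hkt : t < q (k + 1) := hk ▸ Nat.find_spec hex
    have hkt' : (q k : ℝ) ≤ t := not_lt.mp (Nat.find_min hex (by omega))
    have hNk : N + 1 ≤ k := by
      by_contra hcon
      have h2 : (q (k + 1) : ℝ) ≤ q (N + 1) :=
        monotone_nat_of_le_succ (f := fun n => (q n : ℝ)) hqle (by omega)
      linarith
    obtain ⟨l, rfl⟩ : ∃ l, k = l + 1 := ⟨k - 1, by omega⟩
    obtain ⟨hN1, hN2⟩ := hN (l + 1) (by omega)
    have hbest := H.signedError_le_abs hζ (l + 1) hr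
      (by exact_mod_cast hrt.trans_lt hkt) m
    refine lt_of_lt_of_le ?_ hbest
    rcases le_or_gt c 0 with hc0 | hc0
    · have h1 : 0 < Ψ t := hpos t ((hq _).trans_le hkt')
      nlinarith [hζ (l + 1)]
    · have hmono : Ψ t ≤ Ψ (q (l + 1)) := hx₀ _ _ hN2 hkt'
      refine (mul_le_mul_of_nonneg_left hmono hc0.le).trans_lt ?_
      have h1 := H.signedError_lower hζ (l + 1)
      have h2 := mul_le_mul_of_nonneg_right (hupp l) (hζ (l + 1)).le
      have h3 : 1 < (1 / Ψ (q (l + 1)) + 4 * q (l + 1)) * signedError p q ζ (l + 1) :=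
        h1.trans_le h2
      have h4 : Ψ (q (l + 1)) <
          (1 + 4 * (Ψ (q (l + 1)) * q (l + 1))) * signedError p q ζ (l + 1) := by
        have h5 := mul_lt_mul_of_pos_left h3 (hΨ (l + 1))
        have h6 : Ψ (q (l + 1)) * (1 / Ψ (q (l + 1))) = 1 := by
          have := hΨ (l + 1)
          field_simp
        calc Ψ (q (l + 1)) = Ψ (q (l + 1)) * 1 := by ring
          _ < _ := h5
          _ = (Ψ (q (l + 1)) * (1 / Ψ (q (l + 1))) + 4 * (Ψ (q (l + 1)) * q (l + 1))) *
              signedError p q ζ (l + 1) := by ring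
          _ = _ := by rw [h6]
      calc c * Ψ (q (l + 1))
          < c * ((1 + 4 * (Ψ (q (l + 1)) * q (l + 1))) * signedError p q ζ (l + 1)) :=
            mul_lt_mul_of_pos_left h4 hc0
        _ = (c * (1 + 4 * (Ψ (q (l + 1)) * q (l + 1)))) * signedError p q ζ (l + 1) := by ring
        _ ≤ 1 * signedError p q ζ (l + 1) :=
            mul_le_mul_of_nonneg_right hN1.le (hζ (l + 1)).le
        _ = _ := one_mul _

/-- Every open interval contains two Farey neighbours. -/
theorem exists_farey_neighbours {a b : ℝ} (hab : a < b) :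
    ∃ x y : ℤ × ℤ, 0 < x.2 ∧ x.2 ≤ y.2 ∧ y.1 * x.2 - x.1 * y.2 = 1 ∧
      a < (x.1 / x.2 : ℝ) ∧ (y.1 / y.2 : ℝ) < b := by
  obtain ⟨r, har, hrb⟩ := exists_rat_btwn hab
  have hden : (0 : ℤ) < r.den := by exact_mod_cast r.den_pos
  have hdenR : (0 : ℝ) < r.den := by exact_mod_cast r.den_pos
  have hco : IsCoprime (r.den : ℤ) r.num :=
    (Rat.isCoprime_num_den r).symm
  obtain ⟨u, v, huv⟩ := hco
  have hbr : 0 < b - r := sub_pos.mpr hrb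
  -- The second fraction exceeds `r` by the reciprocal of `r.den * (-v + t * r.den)`. This `t` makes
  -- `-v + t * r.den` larger than both `r.den` and `1 / (b - r)`.
  obtain ⟨t, ht⟩ := exists_nat_gt (|v| + r.den + 1 / (b - r) : ℝ)
  have ht0 : (|v| + r.den : ℝ) < t := by
    have : 0 < 1 / (b - r : ℝ) := by positivity
    linarith
  have ht1 : |v| + (r.den : ℤ) < t := by exact_mod_cast ht0
  have hv := le_abs_self v
  have hq : (t : ℤ) - |v| ≤ -v + t * r.den := by nlinarith
  refine ⟨(r.num, r.den), (u + t * r.num, -v + t * r.den), hden, by simp only; linarith, ?_, ?_, ?_⟩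
  · simp only
    linear_combination huv
  · have : ((r.num : ℝ) / ((r.den : ℤ) : ℝ)) = r := by exact_mod_cast Rat.num_div_den r
    exact this ▸ har
  · have hr : (r : ℝ) * r.den = r.num := by exact_mod_cast Rat.mul_den_eq_num r
    have huv' : (u : ℝ) * r.den + v * r.num = 1 := by exact_mod_cast huv
    have hqR : (t : ℝ) - |v| ≤ -v + t * r.den := by exact_mod_cast hq
    have h1 : 1 < (-v + t * r.den : ℝ) * (b - r) := by
      rw [← div_lt_iff₀ hbr]
      linarith
    have h2 : (0 : ℝ) < -v + t * r.den := by linarith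
    have h3 : (1 : ℝ) ≤ r.den := by exact_mod_cast r.den_pos
    push_cast
    rw [div_lt_iff₀ h2]
    have h4 : (u : ℝ) + r * v ≤ 1 := by
      have h5 : ((u : ℝ) + r * v) * r.den = 1 := by linear_combination huv' + v * hr
      nlinarith
    have h6 : (u : ℝ) + t * r.num = (u + r * v) + r * (-v + t * r.den) := by
      linear_combination -(t : ℝ) * hr
    linarith

theorem exists_injective_exactlyApproximable {Ψ : ℝ → ℝ} {a b : ℝ} (hab : a < b)
    (hpos : ∀ t : ℝ, 0 < t → 0 < Ψ t)
    (hdecay : Tendsto (fun t => Ψ t * t) atTop (nhds 0))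
    (hanti : ∃ x₀ : ℝ, ∀ s t : ℝ, x₀ ≤ s → s ≤ t → Ψ t ≤ Ψ s) :
    ∃ f : (ℕ → Bool) → ℝ, Function.Injective f ∧
      ∀ ε, f ε ∈ Ioo a b ∧ ExactlyApproximable Ψ (f ε) := by
  obtain ⟨x, y, hx, hxy, hdet, hax, hyb⟩ := exists_farey_neighbours hab
  choose f hf using fun ε => (isConvergentSeq_pairs hpos hx hxy hdet ε).exists_limit
  refine ⟨f, fun ε ε' h => ?_, fun ε => ⟨⟨?_, ?_⟩, ?_⟩⟩
  · exact bits_eq_of_limit_eq hpos hx hxy hdet (hf ε) (h ▸ hf ε')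
  · have h0 := hf ε 0
    simp only [signedError, convergentPairs, pow_zero, one_mul] at h0
    have hx' : (0 : ℝ) < x.2 := by exact_mod_cast hx
    refine hax.trans ?_
    rw [div_lt_iff₀ hx']
    linarith
  · have h0 := hf ε 1
    simp only [signedError, convergentPairs, pow_one] at h0
    have hy' : (0 : ℝ) < y.2 := by exact_mod_cast hx.trans_le hxy
    refine lt_trans ?_ hyb
    rw [lt_div_iff₀ hy']
    linarith
  · exact exactlyApproximable_of_pairs hpos hdecay hanti hx hxy hdet (hf ε)

/-! ### Admissible functions and powers. -/

theorem Admissible.of_le {k j : ℕ} {Ψ : ℝ → ℝ} (h : Admissible k Ψ) (hjk : j ≤ k) :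
    Admissible j Ψ := by
  obtain ⟨x₀, hx₀, hm⟩ := h.mono
  refine ⟨h.pos, h.decay.trans_isBigO ?_, x₀, hx₀, fun x y hx hxy => ?_⟩
  · refine IsBigO.of_bound 1 ?_
    filter_upwards [eventually_ge_atTop (1 : ℝ)] with x hx
    have hx0 : 0 < x := by linarith
    rw [one_mul, Real.norm_of_nonneg (zpow_pos hx0 _).le, Real.norm_of_nonneg (zpow_pos hx0 _).le]
    exact zpow_le_zpow_right₀ hx (by omega)
  · refine le_trans (zpow_le_zpow_right₀ ?_ (by omega)) (hm x y hx hxy)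
    rw [le_div_iff₀ (hx₀.trans_le hx)]
    linarith

theorem Admissible.eventually_antitone {k : ℕ} {Ψ : ℝ → ℝ} (h : Admissible k Ψ) (hk : 1 ≤ k) :
    ∃ x₀ : ℝ, ∀ s t : ℝ, x₀ ≤ s → s ≤ t → Ψ t ≤ Ψ s := by
  obtain ⟨x₀, hx₀, hm⟩ := (h.of_le hk).mono
  refine ⟨x₀, fun s t hs hst => ?_⟩
  have h1 := hm s t hs hst
  have ht : 0 < Ψ t := h.pos t (by linarith)
  rw [le_div_iff₀ ht] at h1
  simpa using h1

/-- With `Q = t ^ k`, the quantity tending to zero is `Q * psiSeq Ψ k Q`, which is what the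
divisibility argument needs. -/
theorem Admissible.tendsto_mul_pow {k : ℕ} {Ψ : ℝ → ℝ} (h : Admissible k Ψ) (hk : 1 ≤ k) :
    Tendsto (fun t => Ψ t * t ^ (2 * k - 1)) atTop (nhds 0) := by
  refine h.decay.tendsto_div_nhds_zero.congr' ?_
  filter_upwards [eventually_gt_atTop (0 : ℝ)] with t ht
  have : (-2 * (k : ℤ) + 1) = -((2 * k - 1 : ℕ) : ℤ) := by omega
  rw [this, zpow_neg, zpow_natCast, div_inv_eq_mul]

theorem psiSeq_pow (Ψ : ℝ → ℝ) {j : ℕ} (hj : 1 ≤ j) {y : ℝ} (hy : 0 < y) :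
    psiSeq Ψ j (y ^ j) = Ψ y * y ^ (j - 1) := by
  have hj0 : j ≠ 0 := by omega
  have hj1 : (j : ℝ) ≠ 0 := by exact_mod_cast hj0
  unfold psiSeq
  rw [one_div, Real.pow_rpow_inv_natCast hy.le hj0, ← Real.rpow_natCast y j, ← Real.rpow_mul hy.le,
    ← Real.rpow_natCast y (j - 1)]
  congr 2
  rw [Nat.cast_sub hj]
  field_simp
  simp

theorem abs_pow_sub_pow_le_mul {s t M : ℝ} (hs : |s| ≤ M) (ht : |t| ≤ M) (n : ℕ) :
    |s ^ n - t ^ n| ≤ n * M ^ (n - 1) * |s - t| := by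
  refine (abs_pow_sub_pow_le s t n).trans ?_
  rw [mul_assoc, mul_comm]
  have : max |s| |t| ^ (n - 1) ≤ M ^ (n - 1) :=
    pow_le_pow_left₀ (le_max_of_le_left (abs_nonneg s)) (max_le hs ht) _
  gcongr

/-- This is the Lipschitz constant of the `n`-th power on `[-1/2, 1/2]`; that it is at most 1 is why
the interval is confined there. -/
theorem natCast_mul_half_pow_le_one (n : ℕ) : (n : ℝ) * (1 / 2) ^ (n - 1) ≤ 1 := by
  have h : n ≤ 2 ^ (n - 1) := by
    have := Nat.lt_two_pow_self (n := n - 1)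
    omega
  have h' : (n : ℝ) ≤ 2 ^ (n - 1) := by exact_mod_cast h
  rw [one_div, inv_pow, ← div_eq_mul_inv, div_le_one (by positivity)]
  exact h'

/-! ### Transfer to simultaneous approximation of powers. -/

theorem Transcendental.mem_notAlgebraicOfDegreeLE {ζ : ℝ} (h : Transcendental ℚ ζ) (k : ℕ) :
    ζ ∈ notAlgebraicOfDegreeLE k :=
  fun h' => h h'.1

/-- Powers of good rational approximations approximate the successive powers of `ζ`. -/
theorem mem_approxSet_psiSeq {Ψ : ℝ → ℝ} {ζ : ℝ} {j : ℕ} (hΨ : Admissible j Ψ) (hj : 1 ≤ j)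
    (htr : Transcendental ℚ ζ) (hlt : |ζ| < 1 / 2)
    (hup : ∃ᶠ n : ℕ in atTop, ∃ m : ℤ, |n * ζ - m| ≤ Ψ n) : ζ ∈ approxSet j (psiSeq Ψ j) := by
  refine ⟨htr.mem_notAlgebraicOfDegreeLE j, ?_⟩
  have hzero : Tendsto Ψ atTop (nhds 0) := by
    refine squeeze_zero' ?_ ?_ (hΨ.tendsto_mul_pow hj)
    · filter_upwards [eventually_gt_atTop 0] with t ht using (hΨ.pos t ht).le
    · filter_upwards [eventually_ge_atTop 1] with t ht
      exact le_mul_of_one_le_right (hΨ.pos t (by linarith)).le (one_le_pow₀ ht)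
  have hsmall : ∀ᶠ n : ℕ in atTop, Ψ n < 1 / 2 - |ζ| :=
    (hzero.comp tendsto_natCast_atTop_atTop).eventually_lt_const (by linarith)
  refine Set.Infinite.of_image Prod.fst (Set.infinite_of_not_bddAbove ?_)
  rintro ⟨B, hB⟩
  obtain ⟨n, ⟨m, hm⟩, hn, hnB⟩ :=
    (hup.and_eventually (hsmall.and (eventually_gt_atTop B))).exists
  have hn0 : 0 < n := by omega
  have hn0R : (0 : ℝ) < n := by exact_mod_cast hn0
  have hn1R : (1 : ℝ) ≤ n := by exact_mod_cast hn0
  have hmem : n ^ j ∈ Prod.fst '' {v : ℕ × (Fin j → ℤ) | 0 < v.1 ∧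
      ∀ i : Fin j, |ζ ^ ((i : ℕ) + 1) * (v.1 : ℝ) - (v.2 i : ℝ)| ≤ psiSeq Ψ j (v.1 : ℝ)} := by
    refine ⟨(n ^ j, fun i => n ^ (j - (i + 1)) * m ^ ((i : ℕ) + 1)), ⟨by positivity, fun i => ?_⟩,
      rfl⟩
    have hdist : |ζ - m / n| = |n * ζ - m| / n := by
      rw [← abs_of_pos hn0R, ← abs_div, abs_of_pos hn0R]
      congr 1
      field_simp
    have hdist' : |ζ - m / n| ≤ Ψ n := by
      rw [hdist]
      exact (div_le_self (abs_nonneg _) hn1R).trans hm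
    have hr : |(m / n : ℝ)| ≤ 1 / 2 := by
      have h1 := abs_sub_abs_le_abs_sub (m / n : ℝ) ζ
      rw [abs_sub_comm] at h1
      linarith
    have hpow := abs_pow_sub_pow_le_mul hlt.le hr ((i : ℕ) + 1)
    have hpow' : |ζ ^ ((i : ℕ) + 1) - (m / n : ℝ) ^ ((i : ℕ) + 1)| ≤ |ζ - m / n| :=
      hpow.trans (mul_le_of_le_one_left (abs_nonneg _) (natCast_mul_half_pow_le_one _))
    have hi : (i : ℕ) + 1 ≤ j := i.2
    have hsplit : (n : ℝ) ^ j = n ^ (j - (i + 1)) * n ^ ((i : ℕ) + 1) := by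
      rw [← pow_add]
      congr 1
      omega
    have hfac : ζ ^ ((i : ℕ) + 1) * (n : ℝ) ^ j - n ^ (j - (i + 1)) * (m : ℝ) ^ ((i : ℕ) + 1) =
        n ^ j * (ζ ^ ((i : ℕ) + 1) - (m / n : ℝ) ^ ((i : ℕ) + 1)) := by
      rw [mul_sub, div_pow, hsplit]
      field_simp
    push_cast
    rw [hfac, psiSeq_pow Ψ hj hn0R, abs_mul, abs_of_pos (by positivity)]
    calc (n : ℝ) ^ j * |ζ ^ ((i : ℕ) + 1) - (m / n : ℝ) ^ ((i : ℕ) + 1)|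
        ≤ n ^ j * (|n * ζ - m| / n) := by
          rw [← hdist]
          gcongr
      _ = |n * ζ - m| * n ^ (j - 1) := by
          rw [← pow_sub_one_mul (by omega : j ≠ 0)]
          field_simp
      _ ≤ Ψ n * n ^ (j - 1) := by gcongr
  have h1 := hB hmem
  have h2 : n ≤ n ^ j := Nat.le_self_pow (by omega) n
  omega

/-- If the powers of `ζ` are approximated well enough with common denominator `Q`, then `Q` is
divisible by a high power of the reduced denominator of the approximation to `ζ`. -/
theorem pow_dvd_of_approx {ζ δ : ℝ} {j : ℕ} (hζ : |ζ| ≤ 1) {Q q : ℕ} {p : ℤ} {P : ℕ → ℤ}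
    (hQ : 0 < Q) (hq : 0 < q) (hcop : IsCoprime (q : ℤ) p) (hPQ : P 1 * q = p * Q)
    (hqQ : q ∣ Q) (hp : |(p / q : ℝ)| ≤ 1)
    (happ : ∀ i, 1 ≤ i → i ≤ j → |ζ ^ i * Q - P i| ≤ δ) (hδ : (j + 1) * (Q * δ) < 1)
    (i : ℕ) (hi : 1 ≤ i) (hij : i ≤ j) : q ^ i ∣ Q := by
  have hQR : (0 : ℝ) < Q := by exact_mod_cast hQ
  have hqR : (0 : ℝ) < q := by exact_mod_cast hq
  have hδ0 : 0 ≤ δ := (abs_nonneg _).trans (happ i hi hij)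
  induction i, hi using Nat.le_induction with
  | base => simpa using hqQ
  | succ i hi ih =>
    obtain ⟨m, hm⟩ := ih (by omega)
    have hmR : (Q : ℝ) = q ^ i * m := by exact_mod_cast hm
    have hPQR : (P 1 : ℝ) * q = p * Q := by exact_mod_cast hPQ
    -- This integer is `q` times the gap between `Q * (p / q) ^ (i + 1)` and `P (i + 1)`. Both are
    -- near `ζ ^ (i + 1) * Q`, and `q ≤ Q` makes the product less than 1.
    have hE : p ^ (i + 1) * m - q * P (i + 1) = 0 := by
      rw [← Int.abs_lt_one_iff]
      have hreal : ((p ^ (i + 1) * m - q * P (i + 1) : ℤ) : ℝ) =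
          q * ((ζ ^ (i + 1) * Q - P (i + 1)) - Q * (ζ ^ (i + 1) - (p / q : ℝ) ^ (i + 1))) := by
        push_cast
        rw [div_pow, hmR]
        field_simp
        ring
      have hfirst : |Q * (ζ ^ (i + 1) - (p / q : ℝ) ^ (i + 1))| ≤ j * δ := by
        have h1 := abs_pow_sub_pow_le_mul hζ hp (i + 1)
        rw [one_pow, mul_one] at h1
        have h2 : (Q : ℝ) * |ζ - p / q| ≤ δ := by
          have h3 := happ 1 le_rfl (by omega)
          have h4 : ζ ^ 1 * Q - P 1 = Q * (ζ - p / q) := by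
            have : (P 1 : ℝ) = p * Q / q := by
              rw [eq_div_iff hqR.ne']
              exact hPQR
            rw [this]
            ring
          rwa [h4, abs_mul, abs_of_pos hQR] at h3
        rw [abs_mul, abs_of_pos hQR]
        have h5 : ((i + 1 : ℕ) : ℝ) ≤ j := by exact_mod_cast hij
        calc (Q : ℝ) * |ζ ^ (i + 1) - (p / q : ℝ) ^ (i + 1)|
            ≤ Q * ((i + 1 : ℕ) * |ζ - p / q|) := by gcongr
          _ = (i + 1 : ℕ) * (Q * |ζ - p / q|) := by ring
          _ ≤ j * δ := by gcongr
      have hqle : (q : ℝ) ≤ Q := by exact_mod_cast Nat.le_of_dvd hQ hqQ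
      have habs : |((p ^ (i + 1) * m - q * P (i + 1) : ℤ) : ℝ)| < 1 := by
        rw [hreal, abs_mul, abs_of_pos hqR]
        have h6 := abs_sub (ζ ^ (i + 1) * Q - P (i + 1))
          (Q * (ζ ^ (i + 1) - (p / q : ℝ) ^ (i + 1)))
        calc (q : ℝ) * |(ζ ^ (i + 1) * Q - P (i + 1)) - Q * (ζ ^ (i + 1) - (p / q : ℝ) ^ (i + 1))|
            ≤ Q * (δ + j * δ) := by
              gcongr
              have := happ (i + 1) (by omega) hij
              linarith
          _ = (j + 1) * (Q * δ) := by ring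
          _ < 1 := hδ
      exact_mod_cast habs
    have hdvd : (q : ℤ) ∣ m := by
      refine (hcop.pow_right (n := i + 1)).dvd_of_dvd_mul_left ⟨P (i + 1), ?_⟩
      linarith
    rw [hm, pow_succ]
    exact Nat.mul_dvd_mul_left _ (by exact_mod_cast hdvd)

/-- Infinitely many solutions therefore require arbitrarily large denominators. -/
theorem finite_approx_of_le (ζ : ℝ) (j : ℕ) (Φ : ℝ → ℝ) (N : ℕ) :
    {v : ℕ × (Fin j → ℤ) | v.1 ≤ N ∧
      ∀ i : Fin j, |ζ ^ ((i : ℕ) + 1) * (v.1 : ℝ) - (v.2 i : ℝ)| ≤ Φ (v.1 : ℝ)}.Finite := by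
  have hfin : ∀ Q : ℕ, (Set.univ.pi fun i : Fin j =>
      {z : ℤ | |ζ ^ ((i : ℕ) + 1) * (Q : ℝ) - z| ≤ Φ Q}).Finite := by
    intro Q
    refine Set.Finite.pi fun i => ?_
    refine (Set.finite_Icc ⌈ζ ^ ((i : ℕ) + 1) * (Q : ℝ) - Φ Q⌉
      ⌊ζ ^ ((i : ℕ) + 1) * (Q : ℝ) + Φ Q⌋).subset fun z hz => ?_
    rw [mem_ofPred_eq, abs_le] at hz
    rw [mem_Icc, Int.ceil_le, Int.le_floor]
    constructor <;> linarith
  refine ((Set.finite_Iic N).biUnion fun Q _ => (Set.finite_singleton Q).prod (hfin Q)).subset ?_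
  rintro ⟨Q, P⟩ ⟨hQ, hP⟩
  simp only [mem_iUnion]
  exact ⟨Q, hQ, rfl, fun i _ => hP i⟩

theorem not_mem_approxSet_mul_psiSeq {Ψ : ℝ → ℝ} {ζ : ℝ} {j : ℕ} (hΨ : Admissible j Ψ)
    (hj : 1 ≤ j) (hlt : |ζ| < 1 / 2)
    (hlow : ∀ c < 1, ∀ᶠ y : ℝ in atTop, ∀ r : ℤ, 0 < r → (r : ℝ) ≤ y → ∀ m : ℤ,
      c * Ψ y < |r * ζ - m|) {c : ℝ} (hc : c < 1) :
    ζ ∉ approxSet j (fun x => c * psiSeq Ψ j x) := by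
  rintro ⟨-, hinf⟩
  have hsmall : ∀ᶠ y : ℝ in atTop, (j + 1) * (Ψ y * y ^ (2 * j - 1)) < 1 :=
    ((hΨ.tendsto_mul_pow hj).const_mul ((j : ℝ) + 1)).eventually_lt_const (by simp)
  have htop : Tendsto (fun Q : ℕ => (Q : ℝ) ^ ((j : ℝ)⁻¹)) atTop atTop :=
    (tendsto_rpow_atTop (by positivity)).comp tendsto_natCast_atTop_atTop
  -- Negative `c` is replaced by 0 so that the multiplier can be used in products of inequalities.
  have hc' : max c 0 < 1 := max_lt hc one_pos
  obtain ⟨N, hN⟩ := eventually_atTop.mp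
    (htop.eventually ((hsmall.and (hlow _ hc')).and (eventually_ge_atTop 1)))
  refine hinf ((finite_approx_of_le ζ j (fun x => c * psiSeq Ψ j x) N).subset ?_)
  rintro ⟨Q, P⟩ ⟨hQ, hP⟩
  refine ⟨?_, hP⟩
  by_contra hcon
  obtain ⟨⟨h1, h2⟩, hy1⟩ := hN Q (by simpa using (not_le.mp hcon).le)
  set y : ℝ := (Q : ℝ) ^ ((j : ℝ)⁻¹) with hy
  have hj0 : j ≠ 0 := by omega
  have hyQ : y ^ j = Q := Real.rpow_inv_natCast_pow (Nat.cast_nonneg Q) hj0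
  have hy0 : 0 < y := by linarith
  have hΨy : 0 < Ψ y := hΨ.pos y hy0
  have hQR : (0 : ℝ) < Q := by exact_mod_cast hQ
  have hQ1 : (1 : ℝ) ≤ Q := by exact_mod_cast hQ
  have hψ : psiSeq Ψ j Q = Ψ y * y ^ (j - 1) := by rw [← hyQ, psiSeq_pow Ψ hj hy0]
  have hψ0 : 0 < psiSeq Ψ j Q := by rw [hψ]; positivity
  -- Reindexing by exponent; the default 0 is never met for exponents from 1 to `j`.
  let R : ℕ → ℤ := fun i => if h : i - 1 < j then P ⟨i - 1, h⟩ else 0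
  have happ' : ∀ i, 1 ≤ i → i ≤ j → |ζ ^ i * Q - R i| ≤ max c 0 * psiSeq Ψ j Q := by
    intro i hi hij
    have h3 := hP ⟨i - 1, by omega⟩
    have h4 : i - 1 + 1 = i := by omega
    have h5 : i - 1 < j := by omega
    simp only [h4] at h3
    simp only [R, h5, dif_pos]
    exact h3.trans (mul_le_mul_of_nonneg_right (le_max_left _ _) hψ0.le)
  have happ : ∀ i, 1 ≤ i → i ≤ j → |ζ ^ i * Q - R i| ≤ psiSeq Ψ j Q := fun i hi hij =>
    (happ' i hi hij).trans (mul_le_of_le_one_left hψ0.le hc'.le)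
  have hδ : (j + 1) * (Q * psiSeq Ψ j Q) < 1 := by
    have h3 : (Q : ℝ) * psiSeq Ψ j Q = Ψ y * y ^ (2 * j - 1) := by
      have h4 : 2 * j - 1 = j + (j - 1) := by omega
      rw [hψ, ← hyQ, h4, pow_add]
      ring
    rw [h3]
    exact h1
  have hQψ : (Q : ℝ) * psiSeq Ψ j Q ≤ 1 / 2 := by
    have h3 : (1 : ℝ) ≤ j := by exact_mod_cast hj
    nlinarith [mul_pos hQR hψ0]
  obtain ⟨g, q, hg, hgq, hgcd⟩ : ∃ (g q : ℕ), 0 < g ∧ Q = q * g ∧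
      ∃ p : ℤ, R 1 = p * g ∧ IsCoprime (q : ℤ) p := by
    have hgpos : 0 < Int.gcd (Q : ℤ) (R 1) := Int.gcd_pos_of_ne_zero_left _ (by omega)
    obtain ⟨g, a', b', hg0, hco, ha', hb'⟩ := Int.exists_gcd_one' hgpos
    have ha0 : 0 ≤ a' := by
      by_contra hneg
      have : (0 : ℤ) < g := by exact_mod_cast hg0
      have hQ' : (0 : ℤ) < Q := by exact_mod_cast hQ
      nlinarith
    lift a' to ℕ using ha0
    exact ⟨g, a', hg0, by exact_mod_cast ha', b', hb', Int.isCoprime_iff_gcd_eq_one.mpr hco⟩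
  obtain ⟨p, hp, hcop⟩ := hgcd
  have hq : 0 < q := Nat.pos_of_ne_zero fun h => by simp [h] at hgq; omega
  have hqR : (0 : ℝ) < q := by exact_mod_cast hq
  have hgR : (0 : ℝ) < g := by exact_mod_cast hg
  have hQqg : (Q : ℝ) = q * g := by exact_mod_cast hgq
  have hpR : (R 1 : ℝ) = p * g := by exact_mod_cast hp
  have hfirst : |ζ ^ 1 * Q - R 1| = g * |q * ζ - p| := by
    rw [hpR, hQqg, ← abs_of_pos hgR, ← abs_mul, abs_of_pos hgR]
    congr 1
    ring
  have hratio : |(p / q : ℝ)| ≤ 1 := by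
    have h3 : |ζ - p / q| ≤ 1 / 2 := by
      have h4 : |ζ ^ 1 * Q - R 1| = Q * |ζ - p / q| := by
        rw [← abs_of_pos hQR, ← abs_mul, abs_of_pos hQR, hpR, hQqg]
        congr 1
        field_simp
      have h5 := happ 1 le_rfl hj
      rw [h4] at h5
      nlinarith [abs_nonneg (ζ - p / q)]
    have h6 := abs_sub_abs_le_abs_sub (p / q : ℝ) ζ
    rw [abs_sub_comm] at h6
    linarith
  have hdvd : q ^ j ∣ Q := pow_dvd_of_approx (by linarith) hQ hq hcop
    (by rw [hp, hgq]; push_cast; ring) ⟨g, hgq⟩ hratio happ hδ j hj le_rfl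
  have hqy : (q : ℝ) ≤ y := by
    refine le_of_pow_le_pow_left₀ hj0 hy0.le ?_
    rw [hyQ]
    exact_mod_cast Nat.le_of_dvd hQ hdvd
  have hbad := h2 q (by exact_mod_cast hq) (by exact_mod_cast hqy) p
  have hle := happ' 1 le_rfl hj
  rw [hfirst, hψ] at hle
  -- From `y ^ j = Q = q * g` and `q ≤ y`.
  have hgy : y ^ (j - 1) ≤ g := by
    have h3 : y ^ (j - 1) * y = g * q := by
      rw [pow_sub_one_mul hj0, hyQ, hQqg]
      ring
    by_contra h4
    nlinarith
  have h5 : (0 : ℝ) ≤ max c 0 * Ψ y := mul_nonneg (le_max_right _ _) hΨy.le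
  rw [Int.cast_natCast] at hbad
  nlinarith [mul_le_mul_of_nonneg_left hgy h5, mul_lt_mul_of_pos_left hbad hgR]

theorem ExactlyApproximable.mem_exactOrderSet {Ψ : ℝ → ℝ} {ζ : ℝ} {j : ℕ}
    (h : ExactlyApproximable Ψ ζ) (hΨ : Admissible j Ψ) (hj : 1 ≤ j) (htr : Transcendental ℚ ζ)
    (hlt : |ζ| < 1 / 2) : ζ ∈ exactOrderSet j (psiSeq Ψ j) := by
  refine ⟨mem_approxSet_psiSeq hΨ hj htr hlt h.upper, ?_⟩
  simp only [mem_iUnion, not_exists]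
  exact fun c hc => not_mem_approxSet_mul_psiSeq hΨ hj hlt h.lower hc

/-! ### Uncountability. -/

theorem not_countable_of_exactlyApproximable_subset {Ψ : ℝ → ℝ} {a b : ℝ} (hab : a < b)
    (hI : Ioo a b ⊆ Ioo (-1 / 2 : ℝ) (1 / 2)) (hΨ : Admissible 1 Ψ) {S : Set ℝ}
    (hS : ∀ ζ ∈ Ioo a b, ExactlyApproximable Ψ ζ → Transcendental ℚ ζ → |ζ| < 1 / 2 → ζ ∈ S) :
    ¬ S.Countable := by
  intro hcount
  obtain ⟨f, hf, hmem⟩ := exists_injective_exactlyApproximable hab hΨ.pos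
    (by simpa using hΨ.tendsto_mul_pow le_rfl) (hΨ.eventually_antitone le_rfl)
  have hsub : range f ⊆ S ∪ {ζ : ℝ | IsAlgebraic ℚ ζ} := by
    rintro _ ⟨ε, rfl⟩
    by_cases halg : IsAlgebraic ℚ (f ε)
    · exact Or.inr halg
    · have h1 := hI (hmem ε).1
      exact Or.inl (hS _ (hmem ε).1 (hmem ε).2 halg
        (abs_lt.mpr ⟨by linarith [h1.1], h1.2⟩))
  have hrange := (hcount.union (Algebraic.countable ℚ ℝ)).mono hsub
  have : Countable (ℕ → Bool) := by
    rw [← image_univ] at hrange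
    exact countable_univ_iff.mp (countable_of_injective_of_countable_image hf.injOn hrange)
  -- Cantor's diagonal argument.
  obtain ⟨e, he⟩ := exists_surjective_nat (ℕ → Bool)
  obtain ⟨n, hn⟩ := he fun n => !e n n
  simpa using congrFun hn n

theorem corollary1 (Ψ : ℝ → ℝ) (a b : ℝ) (hab : a < b)
    (hI : Ioo a b ⊆ Ioo (-1 / 2 : ℝ) (1 / 2)) :
    (∀ k : ℕ, 1 ≤ k → Admissible k Ψ →
      ¬ ((⋂ (j : ℕ) (_ : 1 ≤ j ∧ j ≤ k), exactOrderSet j (psiSeq Ψ j)) ∩ Ioo a b).Countable) ∧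
    (StrictlyAdmissible Ψ →
      ¬ ((⋂ (j : ℕ) (_ : 1 ≤ j), exactOrderSet j (psiSeq Ψ j)) ∩ Ioo a b).Countable) := by
  constructor
  · intro k hk hΨ
    refine not_countable_of_exactlyApproximable_subset hab hI (hΨ.of_le hk)
      fun ζ hζ hex htr hlt => ⟨?_, hζ⟩
    simp only [mem_iInter]
    exact fun j hj => hex.mem_exactOrderSet (hΨ.of_le hj.2) hj.1 htr hlt
  · intro hΨ
    refine not_countable_of_exactlyApproximable_subset hab hI (hΨ 1 le_rfl)
      fun ζ hζ hex htr hlt => ⟨?_, hζ⟩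
    simp only [mem_iInter]
    exact fun j hj => hex.mem_exactOrderSet (hΨ j hj) hj htr hlt
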